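/- Let $d$ be a natural number and let $\mathcal U_1,\dots,\mathcal U_d$ be nonempty countable sets of strings, each indexed by integers through a fixed injection $e_i:\mathcal U_i\to\mathbb Z$ (for example a bijection with $\mathbb Z$ or with $\mathbb N$); thus a string $x\in\mathcal U_1\times\dots\times\mathcal U_d$ is placed at the point $e(x)=(e_1(x_1),\dots,e_d(x_d))$ of $\mathbb Z^d$. A language is an infinite subset of $\mathcal U_1\times\dots\times\mathcal U_d$. Let $\mathcal X$ be a countable collection of languages. Equip $\mathcal X$ with the topology that has as a basis the sets $U_{L,F}=\{L'\in\mathcal X: F\subseteq L'\subseteq L\}$, where $L\in\mathcal X$ and $F$ is a finite set of strings. Put $\mathcal X^{(0)}=\mathcal X$ and let $\mathcal X^{(i+1)}$ be the set of limit points of $\mathcal X^{(i)}$. Assume that $\mathcal X$ has finite Cantor–Bendixson rank, i.e. $\mathcal X^{(n)}=\emptyset$ for some $n\in\mathbb N$. An algorithm is a function that assigns to each finite sequence of strings a string. An enumeration of a language $K$ is a sequence $w_0,w_1,w_2,\dots$ of elements of $K$ in which every element of $K$ occurs. Against it the algorithm $A$ outputs $o_t=A(w_0,\dots,w_t)$ at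 step $t$; write $S_t=\{w_0,\dots,w_t\}$ and $O=\{o_t: t\ge 0\}$. The algorithm generates in the limit from $K$ if for every enumeration of $K$ there is $t^*$ with $o_t\in K\setminus S_t$ for all $t\ge t^*$; it generates in the limit for $\mathcal X$ if it does so from every $K\in\mathcal X$. With $B_r=\{x: \|e(x)\|_\infty\le r\}$, the lower asymptotic density of $O$ in $K$ is $$\underline d(O,K)=\liminf_{r\to\infty}\frac{|O\cap K\cap B_r|}{|K\cap B_r|}.$$ Then the optimal lower asymptotic density that can be guaranteed is $1/2$, and it is attained: 1. There is an algorithm that generates in the limit for $\mathcal X$ and such that, for every $K\in\mathcal X$ and every enumeration of $K$, the output set $O$ satisfies $\underline d(O,K)\ge 1/2$. 2. For every $K\in\mathcal X$ and every algorithm that generates in the limit from $K$, there is an enumeration of $K$ without repetitions for which $\underline d(O,K)\le 1/2$. -/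

import Mathlib

open Filter Topology

noncomputable section

namespace LangGen

/-! ### The topology on a collection of languages and its Cantor-Bendixson hierarchy -/

section CantorBendixson

variable {S : Type*}

/-- The set `U_{L,F}` of all languages `L'` of the collection `X` with `F ⊆ L' ⊆ L`. -/
def basicOpen (X : Set (Set S)) (L F : Set S) : Set X :=
  {L' | F ⊆ (L' : Set S) ∧ (L' : Set S) ⊆ L}

/-- The topology on `X` generated by the sets `U_{L,F}`, where `L` ranges over `X` and `F` over
the finite sets of strings. -/
abbrev langTopology (X : Set (Set S)) : TopologicalSpace X :=
  TopologicalSpace.generateFrom {V | ∃ L ∈ X, ∃ F : Set S, F.Finite ∧ V = basicOpen X L F}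

/-- The finite levels of the Cantor-Bendixson hierarchy: `X⁽⁰⁾ = X`, and `X⁽ⁱ⁺¹⁾` is the set of
limit points of `X⁽ⁱ⁾`. -/
def cbDerivative (X : Set (Set S)) (n : ℕ) : Set X :=
  (@derivedSet X (langTopology X))^[n] Set.univ

/-- The Cantor-Bendixson rank, that is the least ordinal `α` with `X⁽ᵅ⁾ = ∅`, is finite. -/
def HasFiniteCBRank (X : Set (Set S)) : Prop :=
  ∃ n : ℕ, cbDerivative X n = ∅

end CantorBendixson

/-! ### Language generation in the limit -/

section Generation

variable {S : Type*}

/-- A generation algorithm: it maps the list of the strings revealed so far, oldest first, to the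
string it outputs. -/
abbrev Algorithm (S : Type*) : Type _ := List S → S

/-- `w 0, w 1, w 2, …` is an enumeration of `K`: all its terms are in `K`, and each element of `K`
appears at least once. -/
def Enumerates (w : ℕ → S) (K : Set S) : Prop :=
  Set.range w = K

/-- The set of the strings revealed up to and including step `t`. -/
def revealed (w : ℕ → S) (t : ℕ) : Set S :=
  {x | ∃ s ≤ t, w s = x}

/-- The string that the algorithm outputs at step `t`, after it has seen `w 0, …, w t`. -/
def output (A : Algorithm S) (w : ℕ → S) (t : ℕ) : S :=
  A ((List.range (t + 1)).map w)

/-- The set of all strings that the algorithm ever outputs. -/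
def outputSet (A : Algorithm S) (w : ℕ → S) : Set S :=
  Set.range (output A w)

/-- Whatever the enumeration of `K`, from some step on all outputs are unrevealed strings
of `K`. -/
def GeneratesFrom (A : Algorithm S) (K : Set S) : Prop :=
  ∀ w : ℕ → S, Enumerates w K → ∃ t₀, ∀ t ≥ t₀, output A w t ∈ K \ revealed w t

/-- The algorithm generates in the limit for the collection `X`. -/
def GeneratesInLimit (A : Algorithm S) (X : Set (Set S)) : Prop :=
  ∀ K ∈ X, GeneratesFrom A K

end Generation

/-! ### Lower asymptotic density with respect to boxes centred at the origin -/

section Density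

variable {d : ℕ} {U : Fin d → Type*}

/-- The tuples whose image in `ℤᵈ` under the coordinatewise indexing `e` lies in the box
`[-r, r]ᵈ`. -/
def originBox (e : ∀ i, U i ↪ ℤ) (r : ℕ) : Set (∀ i, U i) :=
  {x | ∀ i, |e i (x i)| ≤ (r : ℤ)}

/-- The lower asymptotic density of `O` in `K`: the limit inferior, as `r → ∞`, of the proportion
of the points of `K` in the box of radius `r` that belong to `O`. All these boxes are finite. -/
def lowerDensity (e : ∀ i, U i ↪ ℤ) (O K : Set (∀ i, U i)) : ℝ :=
  liminf (fun r : ℕ =>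
    ((O ∩ K ∩ originBox e r).ncard : ℝ) / ((K ∩ originBox e r).ncard : ℝ)) atTop

end Density

end LangGen

end

noncomputable section

namespace LangGen

/-! ### Key functions with finite sublevel sets, and densities with logarithmic error -/

section Prelim

variable {S : Type*}

/-- A string of `V` of least key, if `V` is nonempty. -/
def leastIn [Nonempty S] (c : S → ℕ) (V : Set S) : S :=
  Classical.epsilon fun x => x ∈ V ∧ ∀ y ∈ V, c x ≤ c y

lemma leastIn_spec [Nonempty S] (c : S → ℕ) {V : Set S} (hV : V.Nonempty) :
    leastIn c V ∈ V ∧ ∀ y ∈ V, c (leastIn c V) ≤ c y := by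
  refine Classical.epsilon_spec (p := fun x => x ∈ V ∧ ∀ y ∈ V, c x ≤ c y) ?_
  exact ⟨Function.argminOn c V hV, Function.argminOn_mem c V hV,
    fun y hy => Function.argminOn_le c V hy⟩

lemma image_Iio_succ (f : ℕ → S) (t : ℕ) :
    f '' Set.Iio (t + 1) = insert (f t) (f '' Set.Iio t) := by
  rw [← Order.succ_eq_add_one, Order.Iio_succ_eq_insert, Set.image_insert_eq]

/-- The lower density of `O` in `K` with respect to the sublevel sets of a key function. -/
def keyDensity (c : S → ℕ) (O K : Set S) : ℝ :=
  liminf (fun r : ℕ =>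
    ((O ∩ K ∩ {x | c x ≤ r}).ncard : ℝ) / ((K ∩ {x | c x ≤ r}).ncard : ℝ)) atTop

lemma tendsto_ncard_sublevel {c : S → ℕ} (hc : ∀ r, {x | c x ≤ r}.Finite) {K : Set S}
    (hK : K.Infinite) : Tendsto (fun r : ℕ => (K ∩ {x | c x ≤ r}).ncard) atTop atTop := by
  refine tendsto_atTop.2 fun b => ?_
  obtain ⟨F, hFK, hF, hcard⟩ := hK.exists_subset_ncard_eq b
  obtain ⟨r₀, hr₀⟩ := (hF.image c).bddAbove
  filter_upwards [eventually_ge_atTop r₀] with r hr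
  rw [← hcard]
  refine Set.ncard_le_ncard (fun x hx => ⟨hFK hx, ?_⟩) ((hc r).inter_of_right K)
  exact (hr₀ ⟨x, hx, rfl⟩).trans hr

lemma tendsto_log_error (C : ℕ) :
    Tendsto (fun n : ℕ => ((C + Nat.log 2 (n + C) : ℕ) : ℝ) / (n : ℝ)) atTop (𝓝 0) := by
  have h1 : Tendsto (fun n : ℕ => (C : ℝ) / (n : ℝ)) atTop (𝓝 0) :=
    tendsto_const_div_atTop_nhds_zero_nat _
  have h2 : Tendsto (fun n : ℕ => Real.log n / (n : ℝ)) atTop (𝓝 0) :=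
    (Real.isLittleO_log_id_atTop.tendsto_div_nhds_zero).comp tendsto_natCast_atTop_atTop
  have h3 : Tendsto (fun n : ℕ => (C : ℝ) / n + (1 / n + (Real.log n / n) / Real.log 2))
      atTop (𝓝 0) := by
    have := h1.add ((tendsto_const_div_atTop_nhds_zero_nat (1 : ℝ)).add
      (h2.div_const (Real.log 2)))
    simpa using this
  refine tendsto_of_tendsto_of_tendsto_of_le_of_le' tendsto_const_nhds h3
    (Eventually.of_forall fun n => by positivity) ?_
  filter_upwards [eventually_ge_atTop (C + 1)] with n hn
  have hn0 : 0 < n := by omega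
  have hn' : (0 : ℝ) < n := by exact_mod_cast hn0
  have hlog : Nat.log 2 (n + C) ≤ Nat.log 2 n + 1 := by
    rw [← Nat.log_mul_base (by norm_num) hn0.ne']
    exact Nat.log_mono_right (by omega)
  have hl : (Nat.log 2 n : ℝ) ≤ Real.log n / Real.log 2 := by
    have := Real.natLog_le_logb n 2
    simpa [Real.logb] using this
  rw [div_right_comm, ← add_div, ← add_div, div_le_div_iff_of_pos_right hn']
  have : ((C + Nat.log 2 (n + C) : ℕ) : ℝ) ≤ ((C + (Nat.log 2 n + 1) : ℕ) : ℝ) := by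
    exact_mod_cast Nat.add_le_add_left hlog C
  push_cast at this ⊢
  linarith

variable {c : S → ℕ} (hc : ∀ r, {x | c x ≤ r}.Finite) {O K : Set S} (hK : K.Infinite) (C : ℕ)
include hc hK

lemma half_le_keyDensity
    (h : ∀ r, (K ∩ {x | c x ≤ r}).ncard ≤ 2 * (O ∩ K ∩ {x | c x ≤ r}).ncard +
      (C + Nat.log 2 ((K ∩ {x | c x ≤ r}).ncard + C))) :
    1 / 2 ≤ keyDensity c O K := by
  have hn := tendsto_ncard_sublevel hc hK
  have hlim := ((tendsto_log_error C).comp hn).const_mul (1 / 2 : ℝ) |>.const_sub (1 / 2 : ℝ)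
  have hlim' := hlim.liminf_eq
  simp only [mul_zero, sub_zero] at hlim'
  rw [← hlim']
  refine liminf_le_liminf ?_ hlim.isBoundedUnder_ge ?_
  · filter_upwards [hn.eventually_ge_atTop 1] with r hr
    have hpos : (0 : ℝ) < (K ∩ {x | c x ≤ r}).ncard := by exact_mod_cast hr
    have h' : ((K ∩ {x | c x ≤ r}).ncard : ℝ) ≤ 2 * (O ∩ K ∩ {x | c x ≤ r}).ncard +
      ((C + Nat.log 2 ((K ∩ {x | c x ≤ r}).ncard + C) : ℕ) : ℝ) := by exact_mod_cast h r
    simp only [Function.comp]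
    rw [le_div_iff₀ hpos, sub_mul, mul_assoc, div_mul_cancel₀ _ hpos.ne']
    linarith
  -- A real `liminf` is meaningful only for bounded quotients; the bound `1` also covers `0 / 0 = 0`
  -- for small `r`.
  · refine IsBoundedUnder.isCoboundedUnder_ge ⟨1, ?_⟩
    refine eventually_map.2 (Eventually.of_forall fun r => div_le_one_of_le₀ ?_ (by positivity))
    exact_mod_cast Set.ncard_le_ncard (by gcongr; exact Set.inter_subset_right)
      ((hc r).inter_of_right K)

lemma keyDensity_le_half
    (h : ∀ r, 2 * (O ∩ K ∩ {x | c x ≤ r}).ncard ≤ (K ∩ {x | c x ≤ r}).ncard +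
      (C + Nat.log 2 ((K ∩ {x | c x ≤ r}).ncard + C))) :
    keyDensity c O K ≤ 1 / 2 := by
  have hn := tendsto_ncard_sublevel hc hK
  have hlim := ((tendsto_log_error C).comp hn).const_mul (1 / 2 : ℝ) |>.const_add (1 / 2 : ℝ)
  have hlim' := hlim.liminf_eq
  simp only [mul_zero, add_zero] at hlim'
  rw [← hlim']
  refine liminf_le_liminf ?_ ⟨0, ?_⟩ hlim.isBoundedUnder_le.isCoboundedUnder_ge
  · filter_upwards [hn.eventually_ge_atTop 1] with r hr
    have hpos : (0 : ℝ) < (K ∩ {x | c x ≤ r}).ncard := by exact_mod_cast hr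
    have h' : 2 * ((O ∩ K ∩ {x | c x ≤ r}).ncard : ℝ) ≤ (K ∩ {x | c x ≤ r}).ncard +
      ((C + Nat.log 2 ((K ∩ {x | c x ≤ r}).ncard + C) : ℕ) : ℝ) := by exact_mod_cast h r
    simp only [Function.comp]
    rw [div_le_iff₀ hpos, add_mul, mul_assoc, div_mul_cancel₀ _ hpos.ne']
    linarith
  · exact eventually_map.2 (Eventually.of_forall fun r => by positivity)

end Prelim

/-! ### The adversary: no algorithm beats density one half -/

section Adversary

variable {S : Type*} [Nonempty S] (A : Algorithm S) (c : S → ℕ) (K : Set S)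

/-- The history of the game after `t` rounds against `A`: the strings revealed so far, and the
outputs so far. The string revealed next is one of least key in `K` among those not yet revealed
and, unless the round number is a power of two, not yet output. -/
def advState : ℕ → List S × Set S
  | 0 => ([], ∅)
  | t + 1 =>
    let h := advState t
    let x := leastIn c (K \ ({y | y ∈ h.1} ∪ {y | y ∈ h.2 ∧ ¬ ∃ i, t = 2 ^ i}))
    (h.1 ++ [x], insert (A (h.1 ++ [x])) h.2)

/-- The enumeration played against `A`. -/
def advEnum (t : ℕ) : S :=
  leastIn c (K \ ({y | y ∈ (advState A c K t).1} ∪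
    {y | y ∈ (advState A c K t).2 ∧ ¬ ∃ i, t = 2 ^ i}))

lemma advState_fst (t : ℕ) : (advState A c K t).1 = (List.range t).map (advEnum A c K) := by
  induction t with
  | zero => rfl
  | succ t ih =>
    rw [List.range_succ, List.map_append, ← ih]
    rfl

lemma advState_snd (t : ℕ) :
    (advState A c K t).2 = output A (advEnum A c K) '' Set.Iio t := by
  induction t with
  | zero => simp [advState]
  | succ t ih =>
    have : (advState A c K (t + 1)).2 =
      insert (A (advState A c K (t + 1)).1) (advState A c K t).2 := rfl
    rw [this, ih, advState_fst, image_Iio_succ]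
    rfl

variable {K}

lemma advEnum_spec (hK : K.Infinite) (t : ℕ) :
    advEnum A c K t ∈ K ∧ (∀ s < t, advEnum A c K s ≠ advEnum A c K t) ∧
    ((¬ ∃ i, t = 2 ^ i) → ∀ s < t, output A (advEnum A c K) s ≠ advEnum A c K t) ∧
    ∀ y ∈ K, (∀ s < t, advEnum A c K s ≠ y) →
      ((¬ ∃ i, t = 2 ^ i) → ∀ s < t, output A (advEnum A c K) s ≠ y) →
      c (advEnum A c K t) ≤ c y := by
  have hfin : ({y | y ∈ (advState A c K t).1} ∪
      {y | y ∈ (advState A c K t).2 ∧ ¬ ∃ i, t = 2 ^ i}).Finite := by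
    refine (List.finite_toSet _).union (Set.Finite.subset ?_ fun y hy => hy.1)
    rw [advState_snd]
    exact (Set.finite_Iio t).image _
  have hspec := leastIn_spec c (hK.sdiff hfin).nonempty
  rw [← advEnum] at hspec
  obtain ⟨⟨h1, h2⟩, h3⟩ := hspec
  rw [advState_fst, advState_snd] at h2 h3
  refine ⟨h1, fun s hs h => h2 (Or.inl ?_), fun ht s hs h => h2 (Or.inr ⟨⟨s, hs, h⟩, ht⟩),
    fun y hy h4 h5 => h3 y ⟨hy, ?_⟩⟩
  · exact List.mem_map.2 ⟨s, List.mem_range.2 hs, h⟩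
  · rintro (h | ⟨⟨s, hs, h⟩, ht⟩)
    · obtain ⟨s, hs, h⟩ := List.mem_map.1 h
      exact h4 s (List.mem_range.1 hs) h
    · exact h5 ht s hs h

lemma advEnum_injective (hK : K.Infinite) : Function.Injective (advEnum A c K) := by
  intro s t hst
  rcases lt_trichotomy s t with h | h | h
  · exact absurd hst ((advEnum_spec A c hK t).2.1 s h)
  · exact h
  · exact absurd hst.symm ((advEnum_spec A c hK s).2.1 t h)

/-- A string never revealed would be a candidate at every power of two, so infinitely many distinct
strings would have key at most its own. -/
lemma enumerates_advEnum (hc : ∀ r, {x | c x ≤ r}.Finite) (hK : K.Infinite) :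
    Enumerates (advEnum A c K) K := by
  refine Set.Subset.antisymm ?_ fun y hy => ?_
  · rintro _ ⟨t, rfl⟩
    exact (advEnum_spec A c hK t).1
  · by_contra hcon
    have hsub : Set.range (fun i : ℕ => advEnum A c K (2 ^ i)) ⊆ {x | c x ≤ c y} := by
      rintro _ ⟨i, rfl⟩
      exact (advEnum_spec A c hK (2 ^ i)).2.2.2 y hy (fun s _ h => hcon ⟨s, h⟩)
        fun h => absurd ⟨i, rfl⟩ h
    refine Set.infinite_range_of_injective ?_ ((hc (c y)).subset hsub)
    exact (advEnum_injective A c hK).comp (Nat.pow_right_injective le_rfl)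

lemma ncard_pow_two_lt_le (n : ℕ) : {t : ℕ | t < n ∧ ∃ i, t = 2 ^ i}.ncard ≤ Nat.log 2 n + 1 := by
  have hsub : {t : ℕ | t < n ∧ ∃ i, t = 2 ^ i} ⊆
      (fun i => 2 ^ i) '' (Finset.range (Nat.log 2 n + 1) : Set ℕ) := by
    rintro _ ⟨hlt, i, rfl⟩
    refine ⟨i, ?_, rfl⟩
    simpa [Nat.lt_succ_iff] using Nat.le_log_of_pow_le (by norm_num) hlt.le
  refine (Set.ncard_le_ncard hsub (Set.toFinite _)).trans ((Set.ncard_image_le).trans ?_)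
  rw [Set.ncard_coe_finset, Finset.card_range]

lemma keyDensity_advEnum_le (hc : ∀ r, {x | c x ≤ r}.Finite) (hK : K.Infinite)
    (hA : GeneratesFrom A K) :
    keyDensity c (outputSet A (advEnum A c K)) K ≤ 1 / 2 := by
  classical
  set w := advEnum A c K with hw
  have hwspec := advEnum_spec A c hK
  rw [← hw] at hwspec
  have hinj : Function.Injective w := advEnum_injective A c hK
  obtain ⟨t₀, ht₀⟩ := hA w (enumerates_advEnum A c hc hK)
  refine keyDensity_le_half hc hK (t₀ + 1) fun r => ?_
  set O := outputSet A w
  set P := K ∩ {x | c x ≤ r} with hP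
  have hPfin : P.Finite := (hc r).inter_of_right K
  have hsplit : (P \ O).ncard + (O ∩ P).ncard = P.ncard := by
    rw [Set.inter_comm, add_comm, Set.ncard_inter_add_ncard_sdiff_eq_ncard P O hPfin]
  -- the first time at which a string is output
  have hfirst : ∀ z ∈ O, ∃ t, output A w t = z ∧ ∀ s < t, output A w s ≠ z := by
    intro z hz
    exact ⟨Nat.find hz, Nat.find_spec hz, fun s hs => Nat.find_min hz hs⟩
  choose! σ hσ hσmin using hfirst
  have hσinj : Set.InjOn σ O := fun a ha b hb hab => by rw [← hσ a ha, ← hσ b hb, hab]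
  -- Until its first output at time `σ z ≥ t₀`, the string `z` is neither revealed nor output, so it
  -- competes with every choice of the adversary.
  have hlate : ∀ z ∈ O ∩ P, t₀ ≤ σ z → ∀ t ≤ σ z, c (w t) ≤ r := by
    intro z hz hzt t ht
    have hnot := (ht₀ _ hzt).2
    rw [hσ z hz.1] at hnot
    refine ((hwspec t).2.2.2 z hz.2.1 (fun s hs h => hnot ⟨s, by omega, h⟩)
      fun _ s hs h => hσmin z hz.1 s (by omega) h).trans hz.2.2
  have hcover : σ '' (O ∩ P) ⊆
      Set.Iio t₀ ∪ ({t | t < P.ncard ∧ ∃ i, t = 2 ^ i} ∪ w ⁻¹' (P \ O)) := by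
    rintro _ ⟨z, hz, rfl⟩
    by_cases h1 : σ z < t₀
    · exact Or.inl h1
    push Not at h1
    refine Or.inr ?_
    by_cases h2 : ∃ i, σ z = 2 ^ i
    · refine Or.inl ⟨?_, h2⟩
      have hsub : w '' Set.Iic (σ z) ⊆ P := by
        rintro _ ⟨t, ht, rfl⟩
        exact ⟨(hwspec t).1, hlate z hz h1 t ht⟩
      have := Set.ncard_le_ncard hsub hPfin
      rw [Set.ncard_image_of_injective _ hinj, ← Finset.coe_Iic, Set.ncard_coe_finset,
        Nat.card_Iic] at this
      omega
    -- The string revealed at `σ z` was not output earlier, by the adversary's choice, nor is it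
    -- output later, as outputs after `t₀` are unrevealed.
    · refine Or.inr ⟨⟨(hwspec _).1, hlate z hz h1 _ le_rfl⟩, ?_⟩
      rintro ⟨u, hu⟩
      rcases lt_or_ge u (σ z) with h3 | h3
      · exact (hwspec (σ z)).2.2.1 h2 u h3 hu
      · exact (ht₀ u (h1.trans h3)).2 ⟨σ z, h3, hu.symm⟩
  have hpre : (w ⁻¹' (P \ O)).Finite := (hPfin.sdiff).preimage hinj.injOn
  have hpow : {t : ℕ | t < P.ncard ∧ ∃ i, t = 2 ^ i}.Finite :=
    (Set.finite_Iio P.ncard).subset fun t ht => ht.1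
  have h1 : (O ∩ P).ncard ≤ t₀ + ((Nat.log 2 P.ncard + 1) + (P \ O).ncard) := by
    rw [← (hσinj.mono Set.inter_subset_left).ncard_image]
    refine (Set.ncard_le_ncard hcover ((Set.finite_Iio t₀).union (hpow.union hpre))).trans ?_
    refine (Set.ncard_union_le _ _).trans (Nat.add_le_add ?_ ((Set.ncard_union_le _ _).trans
      (Nat.add_le_add (ncard_pow_two_lt_le _) ?_)))
    · rw [← Finset.coe_Iio, Set.ncard_coe_finset, Nat.card_Iio]
    · rw [← Set.ncard_image_of_injective _ hinj]
      exact Set.ncard_le_ncard (Set.image_preimage_subset _ _) hPfin.sdiff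
  have h2 : Nat.log 2 P.ncard ≤ Nat.log 2 (P.ncard + (t₀ + 1)) := Nat.log_mono_right (by omega)
  rw [Set.inter_assoc, ← hP]
  omega

end Adversary


/-! ### Descending chains of hypotheses -/

section Hypotheses

variable {S : Type*} (L : ℕ → Set S)

open Classical in
/-- The working hypothesis at depth `m`, given the set `s` of revealed strings: starting from the
set of all strings, go through `L 0, …, L (m - 1)` and move to each language that contains `s` and
is contained in the current hypothesis. -/
def hyp (s : Set S) : ℕ → Set S
  | 0 => Set.univ
  | m + 1 => if s ⊆ L m ∧ L m ⊆ hyp s m then L m else hyp s m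

lemma hyp_anti (s : Set S) : Antitone (hyp L s) := by
  refine antitone_nat_of_succ_le fun m => ?_
  rw [hyp]
  split_ifs with h
  · exact h.2
  · exact le_rfl

lemma subset_hyp (s : Set S) (m : ℕ) : s ⊆ hyp L s m := by
  induction m with
  | zero => exact Set.subset_univ s
  | succ m ih =>
    rw [hyp]
    split_ifs with h
    · exact h.1
    · exact ih

lemma hyp_infinite [Infinite S] (hL : ∀ m, (L m).Infinite) (s : Set S) (m : ℕ) :
    (hyp L s m).Infinite := by
  induction m with
  | zero => exact Set.infinite_univ
  | succ m ih =>
    rw [hyp]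
    split_ifs with h
    · exact hL m
    · exact ih

/-- The chain is decreasing, so `x` lies in every language adopted up to depth `m`; a new string can
only veto an adoption, and here it vetoes none. -/
lemma hyp_insert {s : Set S} {x : S} {m : ℕ} (hx : x ∈ hyp L s m) :
    hyp L (insert x s) m = hyp L s m := by
  induction m with
  | zero => rfl
  | succ m ih =>
    rw [hyp, hyp, ih (hyp_anti L s m.le_succ hx)]
    congr 1
    rw [hyp] at hx
    split_ifs at hx with h
    · simp [h, Set.insert_subset_iff, hx]
    · refine eq_iff_iff.2 ⟨fun h' => absurd ⟨(Set.subset_insert x s).trans h'.1, h'.2⟩ h,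
        fun h' => absurd h' h⟩

/-- Once the revealed strings of `L k` rule out all earlier languages that do not contain `L k`,
the hypothesis at depth `k + 1` is `L k`. -/
lemma hyp_succ_eq {s : Set S} {k : ℕ} (hs : s ⊆ L k)
    (h : ∀ j ≤ k, s ⊆ L j → L k ⊆ L j) : hyp L s (k + 1) = L k := by
  have key : ∀ m ≤ k, L k ⊆ hyp L s m := by
    intro m hm
    induction m with
    | zero => exact Set.subset_univ _
    | succ m ih =>
      rw [hyp]
      split_ifs with h'
      · exact h m (by omega) h'.1
      · exact ih (by omega)
  rw [hyp, if_pos ⟨hs, key k le_rfl⟩]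

/-- Only finitely many languages precede `L k`, and each one not containing `L k` is excluded by a
single witness that is eventually revealed. -/
lemma exists_hyp_succ_eq {w : ℕ → S} {k : ℕ} (hw : Set.range w = L k) :
    ∃ T, ∀ t ≥ T, hyp L (w '' Set.Iio t) (k + 1) = L k := by
  have hwit : ∀ j, ∃ T, ¬ L k ⊆ L j → ∀ t ≥ T, ¬ w '' Set.Iio t ⊆ L j := by
    intro j
    by_cases hj : L k ⊆ L j
    · exact ⟨0, fun h => absurd hj h⟩
    · obtain ⟨x, hxk, hxj⟩ := Set.not_subset.1 hj
      rw [← hw] at hxk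
      obtain ⟨s, rfl⟩ := hxk
      exact ⟨s + 1, fun _ t ht hsub => hxj (hsub ⟨s, Set.mem_Iio.2 (by omega), rfl⟩)⟩
  choose T hT using hwit
  refine ⟨(Finset.range (k + 1)).sup T, fun t ht => hyp_succ_eq L ?_ fun j hj hsub => ?_⟩
  · rw [← hw]
    exact Set.image_subset_range w _
  · by_contra hcon
    refine hT j hcon t ((Finset.le_sup (f := T) ?_).trans ht) hsub
    exact Finset.mem_range.2 (by omega)

end Hypotheses

/-! ### The generator and its correctness -/

section Generator

variable {S : Type*} [Nonempty S]

/-- The internal state of the generator: the revealed strings, its outputs, the depth of its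
working hypothesis, the depth after the last step whose number was a power of two, the number of
steps made, and the latest output. -/
structure GenState (S : Type*) where
  seen : Set S
  outs : Set S
  depth : ℕ
  mark : ℕ
  time : ℕ
  last : S

variable (c : S → ℕ) (L : ℕ → Set S)

open Classical in
/-- The new depth of the working hypothesis when `x` is revealed: the depth drops until the
hypothesis contains `x`; it grows by one at the powers of two, provided that it has not changed
since the previous power of two. -/
def GenState.newDepth (g : GenState S) (x : S) : ℕ :=
  if x ∈ hyp L g.seen g.depth ∧ g.mark = g.depth ∧ ∃ i, g.time = 2 ^ i then g.depth + 1
  else Nat.findGreatest (fun m => x ∈ hyp L g.seen m) g.depth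

/-- The generator outputs an unused string of least key in its working hypothesis. -/
def GenState.newOutput (g : GenState S) (x : S) : S :=
  leastIn c (hyp L (insert x g.seen) (g.newDepth L x) \ (insert x g.seen ∪ g.outs))

open Classical in
/-- One step of the generator. -/
def GenState.step (g : GenState S) (x : S) : GenState S where
  seen := insert x g.seen
  outs := insert (g.newOutput c L x) g.outs
  depth := g.newDepth L x
  mark := if ∃ i, g.time = 2 ^ i then g.newDepth L x else g.mark
  time := g.time + 1
  last := g.newOutput c L x

/-- The state of the generator after it has seen the strings of a list. -/
def genState (l : List S) : GenState S :=
  l.foldl (GenState.step c L) ⟨∅, ∅, 0, 0, 0, Classical.arbitrary S⟩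

/-- The generator for the list `L` of languages, with respect to the key function `c`. -/
def generator : Algorithm S := fun l => (genState c L l).last

variable (w : ℕ → S)

/-- The state of the generator after `t` strings of the enumeration `w`. -/
def run (t : ℕ) : GenState S := genState c L ((List.range t).map w)

lemma run_succ (t : ℕ) : run c L w (t + 1) = (run c L w t).step c L (w t) := by
  simp [run, genState, List.range_succ]

lemma run_time (t : ℕ) : (run c L w t).time = t := by
  induction t with
  | zero => rfl
  | succ t ih => rw [run_succ, GenState.step, ih]

lemma run_seen (t : ℕ) : (run c L w t).seen = w '' Set.Iio t := by
  induction t with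
  | zero => simp [run, genState]
  | succ t ih =>
    rw [run_succ, GenState.step, ih, image_Iio_succ]

lemma output_generator (t : ℕ) :
    output (generator c L) w t = (run c L w t).newOutput c L (w t) := by
  change (run c L w (t + 1)).last = _
  rw [run_succ, GenState.step]

lemma run_outs (t : ℕ) : (run c L w t).outs = output (generator c L) w '' Set.Iio t := by
  induction t with
  | zero => simp [run, genState]
  | succ t ih =>
    rw [run_succ, GenState.step, ih, image_Iio_succ, output_generator]

/-- The depth of the working hypothesis after `t` strings. -/
def depth (t : ℕ) : ℕ := (run c L w t).depth

/-- The hypothesis at depth `m` after `t` strings. -/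
def hypAt (t m : ℕ) : Set S := hyp L (w '' Set.Iio t) m

lemma depth_succ_cases (t : ℕ) :
    (depth c L w (t + 1) = depth c L w t + 1 ∧ w t ∈ hypAt L w t (depth c L w t) ∧
      (run c L w t).mark = depth c L w t ∧ ∃ i, t = 2 ^ i) ∨
    (depth c L w (t + 1) ≤ depth c L w t ∧ w t ∈ hypAt L w t (depth c L w (t + 1)) ∧
      ∀ m ≤ depth c L w t, w t ∈ hypAt L w t m → m ≤ depth c L w (t + 1)) := by
  classical
  have hd : depth c L w (t + 1) = (run c L w t).newDepth L (w t) := by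
    rw [depth, run_succ, GenState.step]
  rw [GenState.newDepth, run_time, run_seen] at hd
  split_ifs at hd with h
  · exact Or.inl ⟨hd, h⟩
  · refine Or.inr ⟨hd ▸ Nat.findGreatest_le _, ?_, fun m hm hx => ?_⟩
    · rw [hd]
      exact Nat.findGreatest_spec (P := fun m => w t ∈ hyp L (w '' Set.Iio t) m)
        (Nat.zero_le _) (Set.mem_univ _)
    · rw [hd]
      exact Nat.le_findGreatest hm hx

lemma depth_succ_le (t : ℕ) : depth c L w (t + 1) ≤ depth c L w t + 1 := by
  rcases depth_succ_cases c L w t with h | h <;> omega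

lemma depth_succ_of_pow_two {t : ℕ} (ht : ∃ i, t = 2 ^ i)
    (hm : (run c L w t).mark = depth c L w t) (hx : w t ∈ hypAt L w t (depth c L w t)) :
    depth c L w (t + 1) = depth c L w t + 1 := by
  classical
  rw [depth, run_succ, GenState.step, GenState.newDepth, run_time, run_seen]
  exact if_pos ⟨hx, hm, ht⟩

lemma le_depth_succ {t m : ℕ} (hm : m ≤ depth c L w t) (hx : w t ∈ hypAt L w t m) :
    m ≤ depth c L w (t + 1) := by
  rcases depth_succ_cases c L w t with h | h
  · omega
  · exact h.2.2 m hm hx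

/-- A level in force is altered only by a string outside it, and such a string pushes the depth
below that level. -/
lemma hypAt_succ {t m : ℕ} (h₁ : m ≤ depth c L w t) (h₂ : m ≤ depth c L w (t + 1)) :
    hypAt L w (t + 1) m = hypAt L w t m := by
  have hx : w t ∈ hypAt L w t m := by
    rcases depth_succ_cases c L w t with h | h
    · exact hyp_anti L _ h₁ h.2.1
    · exact hyp_anti L _ h₂ h.2.1
  rw [hypAt, image_Iio_succ]
  exact hyp_insert L hx

lemma hypAt_eq {s t m : ℕ} (hst : s ≤ t) (h : ∀ u, s ≤ u → u ≤ t → m ≤ depth c L w u) :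
    hypAt L w t m = hypAt L w s m := by
  induction t, hst using Nat.le_induction with
  | base => rfl
  | succ t hst ih =>
    rw [hypAt_succ c L w (h t hst (by omega)) (h (t + 1) (by omega) le_rfl)]
    exact ih fun u hu hu' => h u hu (by omega)

lemma not_pow_two {i v : ℕ} (h₁ : 2 ^ i < v) (h₂ : v < 2 ^ (i + 1)) : ¬ ∃ j, v = 2 ^ j := by
  rintro ⟨j, rfl⟩
  have := (Nat.pow_lt_pow_iff_right (by norm_num : 1 < 2)).1 h₁
  have := (Nat.pow_lt_pow_iff_right (by norm_num : 1 < 2)).1 h₂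
  omega

lemma run_mark {i v : ℕ} (h₁ : 2 ^ i < v) (h₂ : v ≤ 2 ^ (i + 1)) :
    (run c L w v).mark = depth c L w (2 ^ i + 1) := by
  induction v, (h₁ : 2 ^ i + 1 ≤ v) using Nat.le_induction with
  | base =>
    rw [depth, run_succ, GenState.step, run_time, if_pos ⟨i, rfl⟩]
  | succ v hv ih =>
    rw [run_succ, GenState.step, run_time, if_neg (not_pow_two hv (by omega))]
    exact ih (by omega)

lemma depth_le_of_no_pow_two {i u v : ℕ} (h₁ : 2 ^ i < u) (huv : u ≤ v)
    (h₂ : v ≤ 2 ^ (i + 1)) : depth c L w v ≤ depth c L w u := by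
  induction v, huv using Nat.le_induction with
  | base => exact le_rfl
  | succ v hv ih =>
    rcases depth_succ_cases c L w v with h | h
    · exact absurd h.2.2.2 (not_pow_two (h₁.trans_le hv) (by omega))
    · exact h.1.trans (ih (by omega))

/-- The depth grows only at powers of two, and only if it was constant since the previous one. -/
lemma depth_const_of_lt {t : ℕ} (h : depth c L w t < depth c L w (t + 1)) :
    depth c L w (t + 1) = depth c L w t + 1 ∧ ∃ i, t = 2 ^ i ∧
      ∀ j, i = j + 1 → ∀ v, 2 ^ j < v → v ≤ t → depth c L w v = depth c L w t := by
  rcases depth_succ_cases c L w t with ⟨h₁, -, h₂, i, rfl⟩ | h'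
  · refine ⟨h₁, i, rfl, ?_⟩
    rintro j rfl v hv hv'
    have h₃ := depth_le_of_no_pow_two c L w (Nat.lt_succ_self (2 ^ j)) hv hv'
    have h₄ := depth_le_of_no_pow_two c L w hv hv' le_rfl
    rw [run_mark c L w (Nat.pow_lt_pow_right (by norm_num) (Nat.lt_succ_self j)) le_rfl] at h₂
    exact le_antisymm (h₂ ▸ h₃) h₄
  · omega

variable {L w} {k : ℕ}

/-- The hypothesis `L k` is eventually reached and never abandoned. -/
lemma exists_le_depth (hw : Enumerates w (L k)) :
    ∃ T, ∀ t ≥ T, k + 1 ≤ depth c L w t ∧ hypAt L w t (k + 1) = L k := by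
  obtain ⟨T₀, hT₀⟩ := exists_hyp_succ_eq L hw
  have hmem : ∀ t ≥ T₀, ∀ m ≤ k + 1, w t ∈ hypAt L w t m := by
    intro t ht m hm
    refine hyp_anti L _ hm ?_
    rw [hT₀ t ht, ← hw]
    exact ⟨t, rfl⟩
  have hstay : ∀ m ≤ k + 1, ∀ t ≥ T₀, m ≤ depth c L w t → ∀ u ≥ t, m ≤ depth c L w u := by
    intro m hm t ht hmt u hu
    induction u, hu using Nat.le_induction with
    | base => exact hmt
    | succ u hu ih => exact le_depth_succ c L w ih (hmem u (ht.trans hu) m hm)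
  have key : ∀ m ≤ k + 1, ∃ T ≥ T₀, ∀ t ≥ T, m ≤ depth c L w t := by
    intro m
    induction m with
    | zero => exact fun _ => ⟨T₀, le_rfl, fun t _ => Nat.zero_le _⟩
    | succ m ih =>
      intro hm
      obtain ⟨T, hT, h⟩ := ih (by omega)
      suffices ∃ t ≥ T, m + 1 ≤ depth c L w t by
        obtain ⟨t, ht, hmt⟩ := this
        exact ⟨t, hT.trans ht, hstay (m + 1) hm t (hT.trans ht) hmt⟩
      by_contra! hcon
      have heq : ∀ t ≥ T, depth c L w t = m := fun t ht =>
        le_antisymm (Nat.lt_succ_iff.1 (hcon t ht)) (h t ht)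
      have hTp : T < 2 ^ T := Nat.lt_two_pow_self
      have hp : 2 ^ T < 2 ^ (T + 1) := Nat.pow_lt_pow_right (by norm_num) (Nat.lt_succ_self T)
      -- If the depth were stuck at `m` from `T` on, the mark set at `2 ^ T > T` would still equal
      -- it at the next power of two, which forces growth.
      have h1 := depth_succ_of_pow_two c L w (t := 2 ^ (T + 1)) ⟨T + 1, rfl⟩
        (by rw [run_mark c L w hp le_rfl, heq _ (by omega), heq _ (by omega)])
        (by rw [heq _ (by omega)]; exact hmem _ (by omega) m (by omega))
      rw [heq _ (by omega), heq _ (by omega)] at h1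
      omega
  obtain ⟨T, hT, h⟩ := key (k + 1) le_rfl
  exact ⟨T, fun t ht => ⟨h t ht, hT₀ t (hT.trans ht)⟩⟩

variable (w) in
lemma output_generator_spec [Infinite S] (hL : ∀ m, (L m).Infinite) (t : ℕ) :
    output (generator c L) w t ∈ hypAt L w (t + 1) (depth c L w (t + 1)) ∧
    output (generator c L) w t ∉ w '' Set.Iio (t + 1) ∧
    (∀ s < t, output (generator c L) w s ≠ output (generator c L) w t) ∧
    ∀ y ∈ hypAt L w (t + 1) (depth c L w (t + 1)), y ∉ w '' Set.Iio (t + 1) →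
      (∀ s < t, output (generator c L) w s ≠ y) → c (output (generator c L) w t) ≤ c y := by
  have hd : (run c L w t).newDepth L (w t) = depth c L w (t + 1) := by
    rw [depth, run_succ, GenState.step]
  have hs : insert (w t) (run c L w t).seen = w '' Set.Iio (t + 1) := by
    rw [← run_seen c L w (t + 1), run_succ, GenState.step]
  have ho := output_generator c L w t
  rw [GenState.newOutput, hd, hs, run_outs] at ho
  have hne := ((hyp_infinite L hL (w '' Set.Iio (t + 1)) (depth c L w (t + 1))).sdiff
    (((Set.finite_Iio (t + 1)).image w).union
      ((Set.finite_Iio t).image (output (generator c L) w)))).nonempty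
  have hspec := leastIn_spec c hne
  rw [← ho] at hspec
  obtain ⟨⟨h1, h2⟩, h3⟩ := hspec
  refine ⟨h1, fun h => h2 (Or.inl h), fun s hs h => h2 (Or.inr ⟨s, hs, h⟩),
    fun y hy h4 h5 => h3 y ⟨hy, ?_⟩⟩
  rintro (h | ⟨s, hs, h⟩)
  · exact h4 h
  · exact h5 s hs h

lemma output_generator_injective [Infinite S] (hL : ∀ m, (L m).Infinite) :
    Function.Injective (output (generator c L) w) := by
  intro s t hst
  rcases lt_trichotomy s t with h | h | h
  · exact absurd hst ((output_generator_spec c w hL t).2.2.1 s h)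
  · exact h
  · exact absurd hst.symm ((output_generator_spec c w hL s).2.2.1 t h)

lemma generator_generatesFrom [Infinite S] (hL : ∀ m, (L m).Infinite) (k : ℕ) :
    GeneratesFrom (generator c L) (L k) := by
  intro w hw
  obtain ⟨T, hT⟩ := exists_le_depth c hw
  refine ⟨T, fun t ht => ?_⟩
  obtain ⟨h1, h2, -⟩ := output_generator_spec c w hL t
  obtain ⟨h3, h4⟩ := hT (t + 1) (by omega)
  refine ⟨h4 ▸ hyp_anti L _ h3 h1, ?_⟩
  rintro ⟨s, hs, h⟩
  exact h2 ⟨s, Set.mem_Iio.2 (by omega), h⟩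

end Generator


/-! ### Counting bad times, and density one half for the generator -/

section GeneratorDensity

variable {S : Type*} [Nonempty S] (c : S → ℕ) (L : ℕ → Set S) (w : ℕ → S)

/-- The time since which the depth has been at least its value at time `t`. -/
def ascent (t : ℕ) : ℕ :=
  sInf {s | s ≤ t ∧ ∀ u, s ≤ u → u ≤ t → depth c L w t ≤ depth c L w u}

lemma ascent_spec (t : ℕ) :
    ascent c L w t ≤ t ∧ ∀ u, ascent c L w t ≤ u → u ≤ t → depth c L w t ≤ depth c L w u :=
  Nat.sInf_mem (s := {s | s ≤ t ∧ ∀ u, s ≤ u → u ≤ t → depth c L w t ≤ depth c L w u})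
    ⟨t, le_rfl, fun u hu hu' => by rw [le_antisymm hu hu']⟩

lemma depth_lt_of_ascent_eq {t v : ℕ} (hv : ascent c L w t = v + 1) :
    depth c L w v < depth c L w t := by
  obtain ⟨h1, h2⟩ := ascent_spec c L w t
  by_contra! hcon
  have hmem : v ∈ {s | s ≤ t ∧ ∀ u, s ≤ u → u ≤ t → depth c L w t ≤ depth c L w u} := by
    refine ⟨by omega, fun u hu hu' => ?_⟩
    rcases hu.eq_or_lt with rfl | h
    · exact hcon
    · exact h2 u (by omega) hu'
  have : ascent c L w t ≤ v := Nat.sInf_le hmem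
  omega

/-- Just before the ascent the depth is smaller, and it grows by at most one per step. -/
lemma depth_ascent (t : ℕ) : depth c L w (ascent c L w t) = depth c L w t := by
  obtain ⟨h1, h2⟩ := ascent_spec c L w t
  have h3 := h2 _ le_rfl h1
  refine le_antisymm ?_ h3
  rcases hv : ascent c L w t with _ | v
  · exact Nat.zero_le _
  · have := depth_lt_of_ascent_eq c L w hv
    have := depth_succ_le c L w v
    omega

/-- The times at which a string of norm at most `r` that is never output is revealed for the first
time, and the generator answers with a string of norm greater than `r`. -/
def badTimes (r : ℕ) : Set ℕ :=
  {t | c (w t) ≤ r ∧ w t ∉ outputSet (generator c L) w ∧ (∀ s < t, w s ≠ w t) ∧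
    r < c (output (generator c L) w t)}

variable [Infinite S] {L} (hL : ∀ m, (L m).Infinite)
include hL

lemma ascent_injOn (r : ℕ) : Set.InjOn (fun t => ascent c L w (t + 1)) (badTimes c L w r) := by
  have key : ∀ t ∈ badTimes c L w r, ∀ t' ∈ badTimes c L w r,
      ascent c L w (t + 1) = ascent c L w (t' + 1) → ¬ t < t' := by
    rintro t ⟨-, -, -, h1⟩ t' ⟨h2, h3, h4, -⟩ heq hlt
    have hd : depth c L w (t + 1) = depth c L w (t' + 1) := by
      rw [← depth_ascent, heq, depth_ascent]
    have hmem : w t' ∈ hypAt L w (t' + 1) (depth c L w (t' + 1)) :=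
      subset_hyp L _ _ ⟨t', Set.mem_Iio.2 (Nat.lt_succ_self t'), rfl⟩
    -- With a common ascent the depth is not undercut between the two times, so `w t'` was already
    -- available at time `t`, and the output there would have had norm at most `r`.
    rw [hypAt_eq c L w (s := t + 1) (by omega) fun u hu hu' =>
      (ascent_spec c L w (t' + 1)).2 u
        (by rw [← heq]; exact (ascent_spec c L w (t + 1)).1.trans hu) hu', ← hd] at hmem
    refine absurd ((output_generator_spec c w hL t).2.2.2 (w t') hmem ?_ ?_) (by omega)
    · rintro ⟨s, hs, hst⟩
      exact h4 s ((Nat.lt_succ_iff.1 hs).trans_lt hlt) hst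
    · exact fun s _ h => h3 ⟨s, h⟩
  intro t ht t' ht' heq
  exact le_antisymm (not_lt.1 (key t' ht' t ht heq.symm)) (not_lt.1 (key t ht t' ht' heq))

/-- A bad time is preceded by a long block of outputs of small norm. -/
lemma output_le_of_ascent_eq {r t j : ℕ} (ht : t ∈ badTimes c L w r)
    (hj : ascent c L w (t + 1) = 2 ^ (j + 1) + 1) {u : ℕ} (hu : 2 ^ j ≤ u)
    (hu' : u < 2 ^ (j + 1)) : c (output (generator c L) w u) ≤ r := by
  have h0 := (ascent_spec c L w (t + 1)).1
  have h1 := depth_lt_of_ascent_eq c L w hj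
  have h2 := depth_ascent c L w (t + 1)
  rw [hj] at h2 h0
  obtain ⟨h3, i, hi, h4⟩ := depth_const_of_lt c L w (h2 ▸ h1)
  obtain rfl : j + 1 = i := Nat.pow_right_injective le_rfl hi
  have h5 := h4 j rfl
  have hmem : w t ∈ hypAt L w (t + 1) (depth c L w (u + 1)) := by
    exact subset_hyp L _ _ ⟨t, Set.mem_Iio.2 (Nat.lt_succ_self t), rfl⟩
  rw [hypAt_eq c L w (s := u + 1) (by omega) fun v hv hv' => ?_] at hmem
  · refine ((output_generator_spec c w hL u).2.2.2 (w t) hmem ?_ ?_).trans ht.1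
    · rintro ⟨s, hs, hst⟩
      have := Set.mem_Iio.1 hs
      exact ht.2.2.1 s (by omega) hst
    · exact fun s _ h => ht.2.1 ⟨s, h⟩
  · rw [h5 (u + 1) (by omega) (by omega)]
    -- The level used at `u` survives until `t`: the depth is constant up to `2 ^ (j + 1)` and
    -- strictly larger from the ascent on.
    rcases le_or_gt v (2 ^ (j + 1)) with h | h
    · rw [h5 v (by omega) h]
    · exact h1.le.trans ((ascent_spec c L w (t + 1)).2 v (by omega) hv')

variable {c} {w} {k : ℕ}

lemma ncard_badTimes_le (hc : ∀ r, {x | c x ≤ r}.Finite) {T : ℕ}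
    (hT : ∀ t ≥ T, output (generator c L) w t ∈ L k) (r : ℕ) :
    (badTimes c L w r).Finite ∧ (badTimes c L w r).ncard ≤
      Nat.log 2 ((L k ∩ {x | c x ≤ r}).ncard + T) + 3 := by
  set P := L k ∩ {x | c x ≤ r} with hP
  have hPfin : P.Finite := (hc r).inter_of_right _
  -- The possible ascents: `0`, and `2 ^ i + 1` with `i` at most `log + 1`, which makes `log + 3`
  -- values.
  set B : Finset ℕ := insert 0
    ((Finset.range (Nat.log 2 (P.ncard + T) + 2)).image fun i => 2 ^ i + 1) with hB
  have hmaps : Set.MapsTo (fun t => ascent c L w (t + 1)) (badTimes c L w r) B := by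
    intro t ht
    rw [Finset.mem_coe, hB, Finset.mem_insert, Finset.mem_image]
    rcases hv : ascent c L w (t + 1) with _ | v
    · exact Or.inl hv
    · refine Or.inr ?_
      have h2 := depth_ascent c L w (t + 1)
      rw [hv] at h2
      obtain ⟨-, i, rfl, -⟩ := depth_const_of_lt c L w (h2 ▸ depth_lt_of_ascent_eq c L w hv)
      refine ⟨i, Finset.mem_range.2 ?_, hv.symm⟩
      rcases i with _ | j
      · omega
      -- These outputs are distinct and those from `T` on lie in `L k`, so `2 ^ j ≤ |P| + T`.
      have hsub : output (generator c L) w '' (Finset.Ico (2 ^ j + T) (2 ^ (j + 1)) : Finset ℕ)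
          ⊆ P := by
        rintro _ ⟨u, hu, rfl⟩
        rw [Finset.mem_coe, Finset.mem_Ico] at hu
        exact ⟨hT u (by omega), output_le_of_ascent_eq c w hL ht hv (by omega) hu.2⟩
      have hcard := Set.ncard_le_ncard hsub hPfin
      rw [Set.ncard_image_of_injective _ (output_generator_injective c hL), Set.ncard_coe_finset,
        Nat.card_Ico] at hcard
      have := Nat.le_log_of_pow_le (b := 2) (x := j) (y := P.ncard + T) (by norm_num)
        (by rw [pow_succ] at hcard; omega)
      omega
  have hinj := ascent_injOn c w hL r
  refine ⟨Set.Finite.of_injOn hmaps hinj B.finite_toSet, ?_⟩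
  refine (Set.ncard_le_ncard_of_injOn _ hmaps hinj B.finite_toSet).trans ?_
  rw [Set.ncard_coe_finset]
  refine (Finset.card_insert_le _ _).trans ?_
  have := Finset.card_image_le (s := Finset.range (Nat.log 2 (P.ncard + T) + 2))
    (f := fun i => 2 ^ i + 1)
  rw [Finset.card_range] at this
  omega

/-- The generator attains density `1 / 2` for every sequence of infinite languages, whatever its
Cantor-Bendixson rank. -/
lemma half_le_keyDensity_generator (hc : ∀ r, {x | c x ≤ r}.Finite)
    (hw : Enumerates w (L k)) :
    1 / 2 ≤ keyDensity c (outputSet (generator c L) w) (L k) := by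
  classical
  obtain ⟨T, hT⟩ := generator_generatesFrom c hL k w hw
  refine half_le_keyDensity hc (hL k) (T + 3) fun r => ?_
  obtain ⟨hbfin, hbad⟩ := ncard_badTimes_le hL hc (fun t ht => (hT t ht).1) r
  set O := outputSet (generator c L) w with hO
  set P := L k ∩ {x | c x ≤ r} with hP
  have hPfin : P.Finite := (hc r).inter_of_right _
  have hsplit : (P \ O).ncard + (O ∩ P).ncard = P.ncard := by
    rw [Set.inter_comm, add_comm, Set.ncard_inter_add_ncard_sdiff_eq_ncard P O hPfin]
  have hfirst : ∀ y ∈ P, ∃ t, w t = y ∧ ∀ s < t, w s ≠ y := by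
    intro y hy
    have hy' : ∃ t, w t = y := by
      have := hy.1
      rwa [← hw] at this
    exact ⟨Nat.find hy', Nat.find_spec hy', fun s hs => Nat.find_min hy' hs⟩
  choose! τ hτ hτmin using hfirst
  have hτinj : Set.InjOn τ P := fun a ha b hb hab => by rw [← hτ a ha, ← hτ b hb, hab]
  have hcover : τ '' (P \ O) ⊆
      Set.Iio T ∪ (output (generator c L) w ⁻¹' (O ∩ P) ∪ badTimes c L w r) := by
    rintro _ ⟨y, ⟨hy, hyO⟩, rfl⟩
    by_cases h1 : τ y < T
    · exact Or.inl h1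
    refine Or.inr ?_
    by_cases h2 : c (output (generator c L) w (τ y)) ≤ r
    · exact Or.inl ⟨⟨_, rfl⟩, (hT _ (not_lt.1 h1)).1, h2⟩
    · refine Or.inr ⟨?_, ?_, ?_, not_le.1 h2⟩
      · rw [hτ y hy]
        exact hy.2
      · rwa [hτ y hy]
      · rw [hτ y hy]
        exact hτmin y hy
  have hoinj := output_generator_injective (w := w) c hL
  have hpre : (output (generator c L) w ⁻¹' (O ∩ P)).Finite :=
    (hPfin.inter_of_right O).preimage hoinj.injOn
  have h1 : (P \ O).ncard ≤ T + ((O ∩ P).ncard + (Nat.log 2 (P.ncard + T) + 3)) := by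
    rw [← (hτinj.mono Set.sdiff_subset).ncard_image]
    refine (Set.ncard_le_ncard hcover ((Set.finite_Iio T).union (hpre.union hbfin))).trans ?_
    refine (Set.ncard_union_le _ _).trans (Nat.add_le_add ?_ ((Set.ncard_union_le _ _).trans
      (Nat.add_le_add ?_ hbad)))
    · rw [← Finset.coe_Iio, Set.ncard_coe_finset, Nat.card_Iio]
    · rw [← Set.ncard_image_of_injective _ hoinj]
      exact Set.ncard_le_ncard (Set.image_preimage_subset _ _) (hPfin.inter_of_right O)
  have h2 : Nat.log 2 (P.ncard + T) ≤ Nat.log 2 (P.ncard + (T + 3)) :=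
    Nat.log_mono_right (by omega)
  rw [Set.inter_assoc, ← hP]
  omega

end GeneratorDensity

/-! ### Boxes as sublevel sets of the sup norm -/

section Boxes

variable {d : ℕ} {U : Fin d → Type*} (e : ∀ i, U i ↪ ℤ)

/-- The sup norm of the point of `ℤᵈ` at which a tuple is placed. -/
def tupleNorm (x : ∀ i, U i) : ℕ := Finset.univ.sup fun i => (e i (x i)).natAbs

lemma originBox_eq (r : ℕ) : originBox e r = {x | tupleNorm e x ≤ r} := by
  ext x
  change (∀ i, |e i (x i)| ≤ (r : ℤ)) ↔ Finset.univ.sup (fun i => (e i (x i)).natAbs) ≤ r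
  rw [Finset.sup_le_iff]
  refine ⟨fun h i _ => ?_, fun h i => ?_⟩
  · have := h i
    rw [Int.abs_eq_natAbs] at this
    exact_mod_cast this
  · rw [Int.abs_eq_natAbs]
    exact_mod_cast h i (Finset.mem_univ i)

lemma finite_tupleNorm_le (r : ℕ) : {x | tupleNorm e x ≤ r}.Finite := by
  rw [← originBox_eq]
  have h : (Set.univ.pi fun i : Fin d => e i ⁻¹' Set.Icc (-(r : ℤ)) r).Finite :=
    Set.Finite.pi fun i => (Set.finite_Icc _ _).preimage (e i).injective.injOn
  exact h.subset fun x hx i _ => abs_le.1 (hx i)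

lemma lowerDensity_eq_keyDensity (O K : Set (∀ i, U i)) :
    lowerDensity e O K = keyDensity (tupleNorm e) O K := by
  simp only [lowerDensity, keyDensity, originBox_eq]

end Boxes

end LangGen

end

theorem mainTheorem6 {d : ℕ} {U : Fin d → Type*} [∀ i, Nonempty (U i)]
    (e : ∀ i, U i ↪ ℤ)
    (X : Set (Set (∀ i, U i))) (hcount : X.Countable) (hinf : ∀ L ∈ X, L.Infinite)
    (hrank : LangGen.HasFiniteCBRank X) :
    (∃ A : LangGen.Algorithm (∀ i, U i),
      LangGen.GeneratesInLimit A X ∧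
      ∀ K ∈ X, ∀ w : ℕ → (∀ i, U i), LangGen.Enumerates w K →
        1 / 2 ≤ LangGen.lowerDensity e (LangGen.outputSet A w) K) ∧
    (∀ A : LangGen.Algorithm (∀ i, U i), ∀ K ∈ X, LangGen.GeneratesFrom A K →
      ∃ w : ℕ → (∀ i, U i), LangGen.Enumerates w K ∧ Function.Injective w ∧
        LangGen.lowerDensity e (LangGen.outputSet A w) K ≤ 1 / 2) := by
  have hc := LangGen.finite_tupleNorm_le e
  constructor
  · rcases X.eq_empty_or_nonempty with rfl | hne
    · exact ⟨fun _ => Classical.arbitrary _, fun K hK => absurd hK (Set.notMem_empty K),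
        fun K hK => absurd hK (Set.notMem_empty K)⟩
    · obtain ⟨L, rfl⟩ := hcount.exists_eq_range hne
      have hL : ∀ m, (L m).Infinite := fun m => hinf _ ⟨m, rfl⟩
      -- At depth `0` the hypothesis is the set of all strings, which must never run out of unused
      -- ones.
      have : Infinite (∀ i, U i) := Set.infinite_univ_iff.1 ((hL 0).mono (Set.subset_univ _))
      refine ⟨LangGen.generator (LangGen.tupleNorm e) L, ?_, ?_⟩
      · rintro _ ⟨k, rfl⟩
        exact LangGen.generator_generatesFrom _ hL k
      · rintro _ ⟨k, rfl⟩ w hw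
        rw [LangGen.lowerDensity_eq_keyDensity]
        exact LangGen.half_le_keyDensity_generator hL hc hw
  · intro A K hK hA
    refine ⟨LangGen.advEnum A (LangGen.tupleNorm e) K,
      LangGen.enumerates_advEnum A _ hc (hinf K hK), LangGen.advEnum_injective A _ (hinf K hK), ?_⟩
    rw [LangGen.lowerDensity_eq_keyDensity]
    exact LangGen.keyDensity_advEnum_le A _ hc (hinf K hK) hA
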